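/- Let $Q$ be a finite quiver with vertex set $Q_0$ and arrow set $Q_1$, where an arrow $a$ goes from its tail $ta$ to its head $ha$, let $\mathbb F$ be a field, let $V$ be a finite-dimensional representation of $Q$ over $\mathbb F$, and let $\beta : Q_0 \to \mathbb N$ be a dimension vector. Write $\langle \alpha,\beta\rangle = \sum_{x\in Q_0}\alpha(x)\beta(x) - \sum_{a\in Q_1}\alpha(ta)\beta(ha)$ for the Euler form and $\operatorname{Rep}_\beta(Q)=\prod_{a\in Q_1}\operatorname{Hom}(\mathbb F^{\beta(ta)},\mathbb F^{\beta(ha)})$ for the space of $\beta$-dimensional representations. Call $W\in\operatorname{Rep}_\beta(Q)$ *$(V,\beta)$-general* if $\dim\operatorname{Hom}_Q(V,W)$ is the minimum of $\dim\operatorname{Hom}_Q(V,W')$ over $W'\in\operatorname{Rep}_\beta(Q)$, and put $\operatorname{ext}(V,\beta)=\dim\operatorname{Ext}_Q(V,W)$ for a $(V,\beta)$-general $W$, where $\operatorname{Ext}_Q=\operatorname{Ext}^1$ in the category of representations of $Q$. **Theorem.** For every $d$ the number $\operatorname{ext}(V,d\beta)$ does not depend on the choice of the $(V,d\beta)$-general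 representation, the limit $$\operatorname{ncext}(V,\beta)=\lim_{d\to\infty}\frac{\operatorname{ext}(V,d\beta)}{d}$$ exists, and $$\operatorname{ncext}(V,\beta)=\max\{-\langle \underline{\dim}\,V',\beta\rangle \mid V' \text{ a subrepresentation of } V\},$$ where the maximum is attained. -/

import Mathlib

open CategoryTheory Filter Topology

universe u v w

namespace QuiverRep

noncomputable section

/-- A representation of the quiver `Q` over the field `F`: a vector space at each vertex and a
linear map for each arrow. Finite-dimensionality is a separate hypothesis. -/
abbrev Rep (F : Type u) [Field F] (Q : Type v) [Quiver.{w + 1} Q] :=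
  Q ⥤q ModuleCat.{u} F

/-- The `F`-linear abelian category of representations of `Q`, as functors on the path category. -/
abbrev RepCat (F : Type u) [Field F] (Q : Type v) [Quiver.{w + 1} Q] :=
  Paths Q ⥤ ModuleCat.{u} F

/-- A representation, seen as an object of the category of representations. -/
abbrev Rep.toRepCat {F : Type u} [Field F] {Q : Type v} [Quiver.{w + 1} Q]
    (V : Rep F Q) : RepCat F Q :=
  Paths.lift V

/-- `dim Hom_Q(V, W)`. -/
def homDim {F : Type u} [Field F] {Q : Type v} [Quiver.{w + 1} Q] (V W : Rep F Q) : ℕ :=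
  Module.finrank F (V.toRepCat ⟶ W.toRepCat)

/-- `dim Ext_Q(V, W)`, where `Ext_Q` is `Ext¹` in the abelian category of representations. -/
def extDim {F : Type u} [Field F] {Q : Type v} [Quiver.{w + 1} Q] (V W : Rep F Q) : ℕ :=
  letI : HasExt (RepCat F Q) := HasExt.standard (RepCat F Q)
  Module.finrank F (Abelian.Ext V.toRepCat W.toRepCat 1)

/-- The Euler (Ringel) form
`⟨α, β⟩ = ∑_{x ∈ Q₀} α(x) β(x) - ∑_{a ∈ Q₁} α(ta) β(ha)`. -/
def eulerForm {Q : Type v} [Quiver.{w + 1} Q] [Fintype Q] [∀ x y : Q, Fintype (x ⟶ y)]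
    (α β : Q → ℕ) : ℤ :=
  ∑ x : Q, (α x : ℤ) * (β x : ℤ) -
    ∑ x : Q, ∑ y : Q, ∑ _a : x ⟶ y, (α x : ℤ) * (β y : ℤ)

/-- The representation space `Rep_β(Q) = ∏_{a ∈ Q₁} Hom(F^{β(ta)}, F^{β(ha)})`. -/
abbrev RepSpace (F : Type u) [Field F] {Q : Type v} [Quiver.{w + 1} Q] (β : Q → ℕ) :=
  ∀ x y : Q, (x ⟶ y) → ((Fin (β x) → F) →ₗ[F] (Fin (β y) → F))

/-- The representation given by a point of the representation space. -/
def RepSpace.toRep {F : Type u} [Field F] {Q : Type v} [Quiver.{w + 1} Q] {β : Q → ℕ}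
    (W : RepSpace F β) : Rep F Q where
  obj x := ModuleCat.of F (Fin (β x) → F)
  map {x y} a := ModuleCat.ofHom (W x y a)

/-- `W ∈ Rep_β(Q)` is `(V, β)`-general: `dim Hom_Q(V, W)` takes its minimal value at `W`, that is,
`W` lies in the complement of `{W' | dim Hom_Q(V, W') ≥ t + 1}`, with `t` the minimal value. -/
def IsGeneral {F : Type u} [Field F] {Q : Type v} [Quiver.{w + 1} Q] (V : Rep F Q) (β : Q → ℕ)
    (W : RepSpace F β) : Prop :=
  ∀ W' : RepSpace F β, homDim V W.toRep ≤ homDim V W'.toRep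

theorem exists_isGeneral {F : Type u} [Field F] {Q : Type v} [Quiver.{w + 1} Q] (V : Rep F Q)
    (β : Q → ℕ) : ∃ W : RepSpace F β, IsGeneral V β W :=
  ⟨Function.argmin (fun W : RepSpace F β => homDim V W.toRep),
    fun W' => Function.argmin_le (fun W : RepSpace F β => homDim V W.toRep) W'⟩

/-- `ext(V, β) = dim Ext_Q(V, W)` for a `(V, β)`-general `W`. -/
def genExt {F : Type u} [Field F] {Q : Type v} [Quiver.{w + 1} Q] (V : Rep F Q)
    (β : Q → ℕ) : ℕ :=
  extDim V (exists_isGeneral V β).choose.toRep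

/-- The non-commutative ext, `ncext(V, β) = lim_{d → ∞} ext(V, dβ) / d`. -/
def ncext {F : Type u} [Field F] {Q : Type v} [Quiver.{w + 1} Q] (V : Rep F Q)
    (β : Q → ℕ) : ℝ :=
  limUnder atTop (fun d : ℕ => (genExt V (d • β) : ℝ) / (d : ℝ))

/-- A subrepresentation of `V`: subspaces at the vertices, preserved by the maps of `V`. -/
structure Subrep {F : Type u} [Field F] {Q : Type v} [Quiver.{w + 1} Q] (V : Rep F Q) where
  space : ∀ x : Q, Submodule F (V.obj x)
  map_mem : ∀ {x y : Q} (a : x ⟶ y) (z : V.obj x), z ∈ space x → (V.map a).hom z ∈ space y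

/-- The dimension vector of a subrepresentation. -/
def Subrep.dimVec {F : Type u} [Field F] {Q : Type v} [Quiver.{w + 1} Q] {V : Rep F Q}
    (V' : Subrep V) (x : Q) : ℕ :=
  Module.finrank F (V'.space x)

end

end QuiverRep

universe t

namespace QuiverRep

section Category

variable {F : Type u} [Field F] {Q : Type v} [Quiver.{w + 1} Q]

/-- The differential `⊕_x Hom(V_x, W_x) → ⊕_a Hom(V_ta, W_ha)` whose kernel is `Hom_Q(V, W)` and
whose cokernel is `Ext_Q(V, W)`. -/
def homDiff (V W : Rep F Q) :
    (∀ x : Q, V.obj x →ₗ[F] W.obj x) →ₗ[F] (∀ x y : Q, (x ⟶ y) → (V.obj x →ₗ[F] W.obj y)) where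
  toFun f x y a := f y ∘ₗ (V.map a).hom - (W.map a).hom ∘ₗ f x
  map_add' f g := by
    ext x y a v
    simp only [Pi.add_apply, LinearMap.sub_apply, LinearMap.comp_apply, LinearMap.add_apply,
      map_add]
    abel
  map_smul' c f := by
    ext x y a v
    simp only [Pi.smul_apply, LinearMap.sub_apply, LinearMap.comp_apply, LinearMap.smul_apply,
      map_smul, RingHom.id_apply, smul_sub]

lemma homDiff_apply (V W : Rep F Q) (f : ∀ x : Q, V.obj x →ₗ[F] W.obj x) {x y : Q} (a : x ⟶ y)
    (v : V.obj x) :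
    homDiff V W f x y a v = f y ((V.map a).hom v) - (W.map a).hom (f x v) := rfl

lemma mem_ker_homDiff {V W : Rep F Q} {f : ∀ x : Q, V.obj x →ₗ[F] W.obj x} :
    f ∈ LinearMap.ker (homDiff V W) ↔ ∀ (x y : Q) (a : x ⟶ y) (v : V.obj x),
      f y ((V.map a).hom v) = (W.map a).hom (f x v) := by
  rw [LinearMap.mem_ker]
  constructor
  · intro h x y a v
    rw [← sub_eq_zero, ← homDiff_apply, h]
    rfl
  · intro h
    ext x y a v
    rw [homDiff_apply, h, sub_self]
    rfl

/-- A morphism of representations from linear maps at the vertices commuting with all arrows. -/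
def natTransOfArrows {Φ Ψ : RepCat F Q} (η : ∀ x : Q, Φ.obj x →ₗ[F] Ψ.obj x)
    (h : ∀ (x y : Q) (a : x ⟶ y) (v : Φ.obj x),
      η y ((Φ.map ((Paths.of Q).map a)).hom v) = (Ψ.map ((Paths.of Q).map a)).hom (η x v)) :
    Φ ⟶ Ψ where
  app x := ModuleCat.ofHom (η x)
  naturality x y p := by
    induction p using Paths.induction' with
    | @id x =>
      ext v
      change η x ((Φ.map (𝟙 ((Paths.of Q).obj x))).hom v) =
        (Ψ.map (𝟙 ((Paths.of Q).obj x))).hom (η x v)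
      rw [CategoryTheory.Functor.map_id, CategoryTheory.Functor.map_id]
      rfl
    | @comp x y z p q ih =>
      ext v
      change η z ((Φ.map ((Paths.of Q).map p ≫ q)).hom v) =
        (Ψ.map ((Paths.of Q).map p ≫ q)).hom (η x v)
      rw [Functor.map_comp, Functor.map_comp]
      refine (congrArg (fun g => g.hom ((Φ.map ((Paths.of Q).map p)).hom v)) ih).trans ?_
      exact congrArg (Ψ.map q).hom (h x y p v)

lemma toRepCat_map_arrow (V : Rep F Q) {x y : Q} (a : x ⟶ y) :
    V.toRepCat.map ((Paths.of Q).map a) = V.map a :=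
  Paths.lift_toPath V a

lemma naturality_arrow {Φ Ψ : RepCat F Q} (f : Φ ⟶ Ψ) {x y : Q} (a : x ⟶ y) (v : Φ.obj x) :
    (f.app y).hom ((Φ.map ((Paths.of Q).map a)).hom v) =
      (Ψ.map ((Paths.of Q).map a)).hom ((f.app x).hom v) :=
  congrArg (fun g => g.hom v) (f.naturality ((Paths.of Q).map a))

/-- A morphism between representations from linear maps at the vertices. -/
def repHom {V W : Rep F Q} (f : ∀ x : Q, V.obj x →ₗ[F] W.obj x)
    (h : ∀ (x y : Q) (a : x ⟶ y) (v : V.obj x),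
      f y ((V.map a).hom v) = (W.map a).hom (f x v)) : V.toRepCat ⟶ W.toRepCat :=
  natTransOfArrows f (by
    intro x y a v
    rw [toRepCat_map_arrow, toRepCat_map_arrow]
    exact h x y a v)

lemma repCat_hom_ext {Φ Ψ : RepCat F Q} {f g : Φ ⟶ Ψ}
    (h : ∀ (x : Q) (v : Φ.obj x), (f.app x).hom v = (g.app x).hom v) : f = g := by
  ext x v
  exact h x v

/-- The linear map at a vertex of a morphism of representations. -/
def appLin {V W : Rep F Q} (f : V.toRepCat ⟶ W.toRepCat) (x : Q) : V.obj x →ₗ[F] W.obj x :=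
  (f.app x).hom

lemma rep_naturality {V W : Rep F Q} (f : V.toRepCat ⟶ W.toRepCat) {x y : Q} (a : x ⟶ y)
    (v : V.obj x) :
    appLin f y ((V.map a).hom v) = (W.map a).hom (appLin f x v) := by
  have := naturality_arrow f a v
  rwa [toRepCat_map_arrow, toRepCat_map_arrow] at this

/-- `Hom_Q(V, W)` is the kernel of the differential. -/
def homEquivKer (V W : Rep F Q) :
    (V.toRepCat ⟶ W.toRepCat) ≃ₗ[F] LinearMap.ker (homDiff V W) where
  toFun f := ⟨fun x => appLin f x, mem_ker_homDiff.2 fun _ _ a v => rep_naturality f a v⟩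
  map_add' _ _ := rfl
  map_smul' _ _ := rfl
  invFun f := repHom f.1 (mem_ker_homDiff.1 f.2)
  left_inv _ := repCat_hom_ext fun _ _ => rfl
  right_inv _ := rfl

lemma homDim_eq (V W : Rep F Q) : homDim V W = Module.finrank F (LinearMap.ker (homDiff V W)) :=
  (homEquivKer V W).finrank_eq

/-- Short exactness of a complex of representations can be checked at the vertices. -/
lemma shortExact_of_vertexwise (S : ShortComplex (RepCat F Q))
    (hf : ∀ x : Q, Function.Injective (S.f.app x).hom)
    (hg : ∀ x : Q, Function.Surjective (S.g.app x).hom)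
    (hfg : ∀ (x : Q) (e : S.X₂.obj x), (S.g.app x).hom e = 0 → ∃ w, (S.f.app x).hom w = e) :
    S.ShortExact where
  exact := by
    rw [ShortComplex.exact_iff_isZero_homology, Functor.isZero_iff]
    intro x
    have h : (S.map ((evaluation _ _).obj x)).Exact := by
      rw [ShortComplex.moduleCat_exact_iff]
      exact hfg x
    rw [ShortComplex.exact_iff_isZero_homology] at h
    exact h.of_iso (S.mapHomologyIso ((evaluation _ _).obj x)).symm
  mono_f := by
    have : ∀ x, Mono (S.f.app x) := fun x => (ModuleCat.mono_iff_injective _).2 (hf x)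
    exact NatTrans.mono_of_mono_app _
  epi_g := by
    have : ∀ x, Epi (S.g.app x) := fun x => (ModuleCat.epi_iff_surjective _).2 (hg x)
    exact NatTrans.epi_of_epi_app _

/-- The extension of `V` by `W` with off-diagonal maps `e`. -/
def twist (V W : Rep F Q) (e : ∀ x y : Q, (x ⟶ y) → (V.obj x →ₗ[F] W.obj y)) : Rep F Q where
  obj x := ModuleCat.of F (W.obj x × V.obj x)
  map {x y} a := ModuleCat.ofHom
    (((W.map a).hom ∘ₗ LinearMap.fst F _ _ + e x y a ∘ₗ LinearMap.snd F _ _).prod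
      ((V.map a).hom ∘ₗ LinearMap.snd F _ _))

lemma twist_map (V W : Rep F Q) (e : ∀ x y : Q, (x ⟶ y) → (V.obj x →ₗ[F] W.obj y)) {x y : Q}
    (a : x ⟶ y) (p : W.obj x × V.obj x) :
    ((twist V W e).map a).hom p = ((W.map a).hom p.1 + e x y a p.2, (V.map a).hom p.2) := rfl

/-- The inclusion of `W` into an extension of `V` by `W`. -/
def twistInl (V W : Rep F Q) (e : ∀ x y : Q, (x ⟶ y) → (V.obj x →ₗ[F] W.obj y)) :
    W.toRepCat ⟶ (twist V W e).toRepCat :=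
  repHom (V := W) (W := twist V W e) (fun x => LinearMap.inl F (W.obj x) (V.obj x)) (by
    intro x y a v
    refine Eq.trans ?_ (twist_map V W e a (v, 0)).symm
    simp only [map_zero, add_zero]
    rfl)

/-- The projection to `V` from an extension of `V` by `W`. -/
def twistSnd (V W : Rep F Q) (e : ∀ x y : Q, (x ⟶ y) → (V.obj x →ₗ[F] W.obj y)) :
    (twist V W e).toRepCat ⟶ V.toRepCat :=
  repHom (V := twist V W e) (W := V) (fun x => LinearMap.snd F (W.obj x) (V.obj x))
    (fun _ _ _ _ => rfl)

/-- The short complex `W → E → V` of an extension with given off-diagonal maps. -/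
@[simps]
def twistComplex (V W : Rep F Q) (e : ∀ x y : Q, (x ⟶ y) → (V.obj x →ₗ[F] W.obj y)) :
    ShortComplex (RepCat F Q) where
  X₁ := W.toRepCat
  X₂ := (twist V W e).toRepCat
  X₃ := V.toRepCat
  f := twistInl V W e
  g := twistSnd V W e
  zero := repCat_hom_ext fun _ _ => rfl

lemma twistComplex_shortExact (V W : Rep F Q)
    (e : ∀ x y : Q, (x ⟶ y) → (V.obj x →ₗ[F] W.obj y)) : (twistComplex V W e).ShortExact := by
  apply shortExact_of_vertexwise
  · intro x
    exact LinearMap.inl_injective (R := F) (M := W.obj x) (M₂ := V.obj x)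
  · intro x
    exact LinearMap.snd_surjective (R := F) (M := W.obj x) (M₂ := V.obj x)
  · rintro x ⟨w, v⟩ (h : v = 0)
    subst h
    exact ⟨w, rfl⟩

lemma countable_path [Finite Q] [∀ x y : Q, Finite (x ⟶ y)] (x y : Q) :
    Countable (Quiver.Path x y) := by
  let enc : ∀ z : Q, Quiver.Path x z → List (Σ a b : Q, (a ⟶ b)) := fun z p =>
    Quiver.Path.rec (motive := fun _ _ => List (Σ a b : Q, (a ⟶ b))) []
      (fun {b c} _ a l => ⟨b, c, a⟩ :: l) p
  have henc : ∀ (z : Q) (p q : Quiver.Path x z), enc z p = enc z q → p = q := by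
    intro z p
    induction p with
    | nil =>
      intro q h
      cases q with
      | nil => rfl
      | cons q a => exact absurd h (List.cons_ne_nil _ _).symm
    | cons p a ih =>
      intro q h
      cases q with
      | nil => exact absurd h (List.cons_ne_nil _ _)
      | cons q b =>
        obtain ⟨h₁, h₂⟩ := List.cons.inj h
        obtain ⟨rfl, h₃⟩ := Sigma.mk.inj h₁
        obtain ⟨-, h₄⟩ := Sigma.mk.inj (eq_of_heq h₃)
        rw [eq_of_heq h₄, ih q h₂]
  exact Function.Injective.countable (f := enc y) fun p q => henc y p q

lemma exists_projective_epi [Finite Q] [∀ x y : Q, Finite (x ⟶ y)] (Φ : RepCat F Q) :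
    ∃ (P : RepCat F Q) (π : P ⟶ Φ), Projective P ∧ Epi π := by
  have : ∀ a b : Paths Q, Limits.HasCoproductsOfShape (a ⟶ b) (ModuleCat.{u} F) := by
    intro a b
    have : Countable (a ⟶ b) := countable_path (Q := Q) a b
    exact Limits.hasColimitsOfShape_of_equivalence
      (Discrete.equivalence (equivShrink.{u} (a ⟶ b)).symm)
  have : Finite (Paths Q) := inferInstanceAs (Finite Q)
  let L : ∀ x : Paths Q, RepCat F Q := fun x =>
    (evaluationLeftAdjoint (ModuleCat.{u} F) x).obj (Φ.obj x)
  have : ∀ x, Projective (L x) := fun x =>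
    (evaluationAdjunctionRight (ModuleCat.{u} F) x).map_projective _ inferInstance
  let π : ∐ L ⟶ Φ := Limits.Sigma.desc fun x =>
    (evaluationAdjunctionRight (ModuleCat.{u} F) x).counit.app Φ
  have hL : Projective (∐ L) :=
    ⟨fun f e _ => ⟨Limits.Sigma.desc fun x => Projective.factorThru (Limits.Sigma.ι L x ≫ f) e,
      Limits.Sigma.hom_ext _ _ fun x => by
        rw [← Category.assoc, Limits.Sigma.ι_desc, Projective.factorThru_comp]⟩⟩
  refine ⟨∐ L, π, hL, ?_⟩
  have : ∀ x, Epi (π.app x) := by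
    intro x
    have h : (evaluationAdjunctionRight (ModuleCat.{u} F) x).unit.app (Φ.obj x) ≫
        (Limits.Sigma.ι L x).app x ≫ π.app x = 𝟙 _ := by
      rw [← NatTrans.comp_app, Limits.Sigma.ι_desc]
      exact (evaluationAdjunctionRight (ModuleCat.{u} F) x).right_triangle_components Φ
    rw [← Category.assoc] at h
    exact (SplitEpi.mk _ h).epi
  exact NatTrans.epi_of_epi_app _

open Abelian

section Ext

variable [HasExt.{t} (RepCat F Q)]

/-- The class in `Ext¹` of the extension with given off-diagonal maps. -/
noncomputable def twistClass (V W : Rep F Q)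
    (e : ∀ x y : Q, (x ⟶ y) → (V.obj x →ₗ[F] W.obj y)) : Ext V.toRepCat W.toRepCat 1 :=
  (twistComplex_shortExact V W e).extClass

lemma twistClass_comp (V : Rep F Q) {W W' : Rep F Q}
    (e : ∀ x y : Q, (x ⟶ y) → (V.obj x →ₗ[F] W.obj y))
    (e' : ∀ x y : Q, (x ⟶ y) → (V.obj x →ₗ[F] W'.obj y)) (f : W.toRepCat ⟶ W'.toRepCat)
    (h : ∀ (x y : Q) (a : x ⟶ y) (v : V.obj x), appLin f y (e x y a v) = e' x y a v) :
    (twistClass V W e).comp (Ext.mk₀ f) (add_zero 1) = twistClass V W' e' := by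
  let φ : twistComplex V W e ⟶ twistComplex V W' e' :=
    { τ₁ := f
      τ₂ := repHom (V := twist V W e) (W := twist V W' e')
        (fun x => LinearMap.prodMap (appLin f x) LinearMap.id) (by
          rintro x y a ⟨p, v⟩
          refine Prod.ext ?_ rfl
          change appLin f y ((W.map a).hom p + e x y a v) =
            (W'.map a).hom (appLin f x p) + e' x y a v
          rw [map_add, rep_naturality, h])
      τ₃ := 𝟙 _
      comm₁₂ := repCat_hom_ext fun x v => by
        rfl
      comm₂₃ := repCat_hom_ext fun _ _ => rfl }
  have := ShortComplex.ShortExact.extClass_naturality (twistComplex_shortExact V W e)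
    (twistComplex_shortExact V W' e') φ
  refine this.trans ?_
  exact Ext.mk₀_id_comp _

/-- The direct sum of two representations. -/
def prodRep (W W' : Rep F Q) : Rep F Q where
  obj x := ModuleCat.of F (W.obj x × W'.obj x)
  map a := ModuleCat.ofHom (LinearMap.prodMap (W.map a).hom (W'.map a).hom)

/-- The class of an extension as a linear function of the off-diagonal maps. -/
noncomputable def twistClassHom (V W : Rep F Q) :
    (∀ x y : Q, (x ⟶ y) → (V.obj x →ₗ[F] W.obj y)) →ₗ[F] Ext V.toRepCat W.toRepCat 1 where
  toFun := twistClass V W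
  map_add' e e' := by
    let p₁ : (prodRep W W).toRepCat ⟶ W.toRepCat :=
      repHom (V := prodRep W W) (fun x => LinearMap.fst F (W.obj x) (W.obj x)) (fun _ _ _ _ => rfl)
    let p₂ : (prodRep W W).toRepCat ⟶ W.toRepCat :=
      repHom (V := prodRep W W) (fun x => LinearMap.snd F (W.obj x) (W.obj x)) (fun _ _ _ _ => rfl)
    let E : ∀ x y : Q, (x ⟶ y) → (V.obj x →ₗ[F] (prodRep W W).obj y) :=
      fun x y a => (e x y a).prod (e' x y a)
    rw [← twistClass_comp V E e p₁ (fun _ _ _ _ => rfl),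
      ← twistClass_comp V E e' p₂ (fun _ _ _ _ => rfl),
      ← twistClass_comp V E (e + e') (p₁ + p₂) (fun _ _ _ _ => rfl), Ext.mk₀_add, Ext.comp_add]
  map_smul' c e := by
    rw [← twistClass_comp V e (c • e) (c • 𝟙 _) (fun _ _ _ _ => rfl), Ext.mk₀_smul, Ext.comp_smul,
      Ext.comp_mk₀_id]
    rfl

lemma ker_twistClassHom (V W : Rep F Q) :
    LinearMap.ker (twistClassHom V W) = LinearMap.range (homDiff V W) := by
  ext e
  rw [LinearMap.mem_ker, LinearMap.mem_range]
  change twistClass V W e = 0 ↔ _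
  constructor
  · intro h
    obtain ⟨t, ht⟩ := Ext.covariant_sequence_exact₃ V.toRepCat (twistComplex_shortExact V W e)
      (Ext.mk₀ (𝟙 V.toRepCat)) (zero_add 1) (by
        refine (Ext.mk₀_id_comp _).trans h)
    obtain ⟨s, rfl⟩ := (Ext.mk₀_bijective _ _).2 t
    rw [Ext.mk₀_comp_mk₀] at ht
    have hs : s ≫ twistSnd V W e = 𝟙 _ := (Ext.mk₀_bijective _ _).1 ht
    have hs' : ∀ (x : Q) (v : V.obj x), Prod.snd (appLin (W := twist V W e) s x v) = v :=
      fun x v => congrArg (fun f : V.toRepCat ⟶ V.toRepCat => (f.app x).hom v) hs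
    refine ⟨fun x => LinearMap.fst F (W.obj x) (V.obj x) ∘ₗ appLin (W := twist V W e) s x, ?_⟩
    ext x y a v
    rw [homDiff_apply]
    have h₁ := congrArg Prod.fst ((rep_naturality (W := twist V W e) s a v).trans
      (twist_map V W e a _))
    rw [sub_eq_iff_eq_add]
    refine h₁.trans ?_
    simp only
    rw [hs' x v, add_comm]
    rfl
  · rintro ⟨σ, rfl⟩
    let s : V.toRepCat ⟶ (twist V W (homDiff V W σ)).toRepCat :=
      repHom (W := twist V W (homDiff V W σ)) (fun x => (σ x).prod LinearMap.id) (by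
        intro x y a v
        refine Prod.ext ?_ rfl
        change σ y ((V.map a).hom v) = (W.map a).hom (σ x v) + homDiff V W σ x y a v
        rw [homDiff_apply]
        abel)
    have hs : s ≫ twistSnd V W (homDiff V W σ) = 𝟙 _ := repCat_hom_ext fun _ _ => rfl
    have h := (twistComplex_shortExact V W (homDiff V W σ)).comp_extClass
    have h' : (Ext.mk₀ s).comp ((Ext.mk₀ (twistSnd V W (homDiff V W σ))).comp
        (twistClass V W (homDiff V W σ)) (zero_add 1)) (zero_add 1) = 0 :=
      (congrArg (fun t => (Ext.mk₀ s).comp t (zero_add 1)) h).trans (Ext.comp_zero _ _ _ _ _)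
    rwa [Ext.mk₀_comp_mk₀_assoc, hs, Ext.mk₀_id_comp] at h'

lemma twistClassHom_surjective [Finite Q] [∀ x y : Q, Finite (x ⟶ y)] (V W : Rep F Q) :
    Function.Surjective (twistClassHom V W) := by
  intro c
  obtain ⟨P, π, hP, hπ⟩ := exists_projective_epi V.toRepCat
  let S : ShortComplex (RepCat F Q) := ShortComplex.mk (Limits.kernel.ι π) π (by simp)
  have hS : S.ShortExact :=
    { exact := ShortComplex.exact_of_f_is_kernel _ (Limits.kernelIsKernel π)
      mono_f := inferInstanceAs (Mono (Limits.kernel.ι π))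
      epi_g := hπ }
  obtain ⟨l, hl⟩ := Ext.contravariant_sequence_exact₃ hS W.toRepCat c
    (Ext.eq_zero_of_projective _) (add_zero 1)
  obtain ⟨l, rfl⟩ := (Ext.mk₀_bijective _ _).2 l
  have hsplit : ∀ x : Q, ∃ (r : P.obj x →ₗ[F] S.X₁.obj x) (s : V.obj x →ₗ[F] P.obj x),
      (∀ k, r ((S.f.app x).hom k) = k) ∧ ∀ p, (S.f.app x).hom (r p) + s ((π.app x).hom p) = p := by
    intro x
    let T := S.map ((evaluation _ _).obj (show Paths Q from x))
    have : Projective T.X₃ := inferInstanceAs (Projective (V.obj x))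
    have σ : T.Splitting :=
      (hS.map_of_exact ((evaluation _ _).obj (show Paths Q from x))).splittingOfProjective
    exact ⟨σ.r.hom, σ.s.hom, fun k => congrArg (fun f => f.hom k) σ.f_r,
      fun p => congrArg (fun f => f.hom p) σ.id⟩
  choose r s hr hs using hsplit
  let e : ∀ x y : Q, (x ⟶ y) → (V.obj x →ₗ[F] W.obj y) := fun x y a =>
    (l.app y).hom ∘ₗ r y ∘ₗ (P.map ((Paths.of Q).map a)).hom ∘ₗ s x
  let φ : S ⟶ twistComplex V W e :=
    { τ₁ := l
      τ₂ := natTransOfArrows (Φ := P) (Ψ := (twist V W e).toRepCat)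
        (fun x => ((l.app x).hom ∘ₗ r x).prod (π.app x).hom) (by
          intro x y a p
          rw [toRepCat_map_arrow]
          refine Eq.trans ?_ (twist_map V W e a ((l.app x).hom (r x p), (π.app x).hom p)).symm
          refine Prod.ext ?_ ((naturality_arrow π a p).trans ?_)
          · change (l.app y).hom (r y ((P.map ((Paths.of Q).map a)).hom p)) =
              (W.map a).hom ((l.app x).hom (r x p)) + e x y a ((π.app x).hom p)
            have h₁ := naturality_arrow l a (r x p)
            rw [toRepCat_map_arrow] at h₁
            refine Eq.trans ?_ (congrArg (· + e x y a ((π.app x).hom p)) h₁)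
            have h₂ := naturality_arrow S.f a (r x p)
            have h₃ := hr y ((S.X₁.map ((Paths.of Q).map a)).hom (r x p))
            rw [h₂] at h₃
            rw [← h₃]
            let g : P.obj x →ₗ[F] W.obj y :=
              (l.app y).hom ∘ₗ r y ∘ₗ (P.map ((Paths.of Q).map a)).hom
            exact (congrArg g (hs x p)).symm.trans (map_add g _ _)
          · rw [toRepCat_map_arrow]
            rfl)
      τ₃ := 𝟙 _
      comm₁₂ := repCat_hom_ext fun x k => by
        have h₁ : (π.app x).hom ((S.f.app x).hom k) = 0 :=
          congrArg (fun f : S.X₁ ⟶ S.X₃ => (f.app x).hom k) S.zero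
        exact Prod.ext (congrArg (l.app x).hom (hr x k)).symm h₁.symm
      comm₂₃ := repCat_hom_ext fun _ _ => rfl }
  refine ⟨e, ?_⟩
  refine Eq.trans ?_ hl
  refine Eq.trans ?_ (ShortComplex.ShortExact.extClass_naturality hS
    (twistComplex_shortExact V W e) φ).symm
  exact (Ext.mk₀_id_comp _).symm

end Ext

lemma extDim_eq [Finite Q] [∀ x y : Q, Finite (x ⟶ y)] (V W : Rep F Q) :
    extDim V W = Module.finrank F
      ((∀ x y : Q, (x ⟶ y) → (V.obj x →ₗ[F] W.obj y)) ⧸ LinearMap.range (homDiff V W)) := by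
  let : HasExt (RepCat F Q) := HasExt.standard (RepCat F Q)
  rw [← ker_twistClassHom]
  exact ((twistClassHom V W).quotKerEquivOfSurjective
    (twistClassHom_surjective V W)).finrank_eq.symm

end Category

section Dimension

variable {F : Type u} [Field F] {Q : Type v} [Quiver.{w + 1} Q]

/-- A subrepresentation, as a representation. -/
noncomputable def Subrep.toRep {V : Rep F Q} (K : Subrep V) : Rep F Q where
  obj x := ModuleCat.of F (K.space x)
  map a := ModuleCat.ofHom ((V.map a).hom.restrict (K.map_mem a))

/-- Restriction of a family of maps at the arrows to a subrepresentation. -/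
noncomputable def Subrep.restrictArrows {V : Rep F Q} (K : Subrep V) (W : Rep F Q) :
    (∀ x y : Q, (x ⟶ y) → (V.obj x →ₗ[F] W.obj y)) →ₗ[F]
      (∀ x y : Q, (x ⟶ y) → (K.toRep.obj x →ₗ[F] W.obj y)) where
  toFun e x y a := e x y a ∘ₗ (K.space x).subtype
  map_add' _ _ := rfl
  map_smul' _ _ := rfl

lemma Subrep.restrictArrows_surjective {V : Rep F Q} (K : Subrep V) (W : Rep F Q) :
    Function.Surjective (K.restrictArrows W) := by
  intro e
  choose e' he' using fun x y a => LinearMap.exists_extend (p := K.space x) (e x y a)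
  exact ⟨e', funext fun x => funext fun y => funext fun a => he' x y a⟩

lemma Subrep.homDiff_restrict {V : Rep F Q} (K : Subrep V) (W : Rep F Q)
    (f : ∀ x : Q, V.obj x →ₗ[F] W.obj x) :
    homDiff K.toRep W (fun x => f x ∘ₗ (K.space x).subtype) =
      K.restrictArrows W (homDiff V W f) := rfl

variable [Fintype Q] [∀ x y : Q, Fintype (x ⟶ y)]

lemma eulerForm_finrank (U : Rep F Q) [∀ x : Q, Module.Finite F (U.obj x)] (γ : Q → ℕ) :
    eulerForm (fun x => Module.finrank F (U.obj x)) γ =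
      (Module.finrank F (∀ x : Q, U.obj x →ₗ[F] (Fin (γ x) → F)) : ℤ) -
        Module.finrank F (∀ x y : Q, (x ⟶ y) → (U.obj x →ₗ[F] (Fin (γ y) → F))) := by
  have hγ : ∀ x, Module.finrank F (Fin (γ x) → F) = γ x := fun x => Module.finrank_fin_fun F
  have h₁ : Module.finrank F (∀ x : Q, U.obj x →ₗ[F] (Fin (γ x) → F)) =
      ∑ x : Q, Module.finrank F (U.obj x) * γ x := by
    rw [Module.finrank_pi_fintype]
    simp only [Module.finrank_linearMap, hγ]
  have h₂ : Module.finrank F (∀ x y : Q, (x ⟶ y) → (U.obj x →ₗ[F] (Fin (γ y) → F))) =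
      ∑ x : Q, ∑ y : Q, ∑ _a : x ⟶ y, Module.finrank F (U.obj x) * γ y := by
    simp only [Module.finrank_pi_fintype (R := F) (ι := Q),
      Module.finrank_pi_fintype (R := F) (ι := _ ⟶ _), Module.finrank_linearMap, hγ]
  rw [h₁, h₂]
  push_cast
  rfl

lemma homDim_sub_extDim (U : Rep F Q) [∀ x : Q, Module.Finite F (U.obj x)] {γ : Q → ℕ}
    (W : RepSpace F γ) :
    (homDim U W.toRep : ℤ) - extDim U W.toRep =
      eulerForm (fun x => Module.finrank F (U.obj x)) γ := by
  have : ∀ x : Q, Module.Finite F (W.toRep.obj x) := fun x =>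
    inferInstanceAs (Module.Finite F (Fin (γ x) → F))
  rw [homDim_eq, extDim_eq]
  have h₁ := (homDiff U W.toRep).finrank_range_add_finrank_ker
  have h₂ := (LinearMap.range (homDiff U W.toRep)).finrank_quotient_add_finrank
  have h₃ : _ = (Module.finrank F (∀ x : Q, U.obj x →ₗ[F] W.toRep.obj x) : ℤ) -
      Module.finrank F (∀ x y : Q, (x ⟶ y) → (U.obj x →ₗ[F] W.toRep.obj y)) :=
    eulerForm_finrank U γ
  rw [h₃]
  zify at h₁ h₂
  linarith

lemma genExt_eq_of_isGeneral (V : Rep F Q) [∀ x : Q, Module.Finite F (V.obj x)] {γ : Q → ℕ}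
    {W : RepSpace F γ} (hW : IsGeneral V γ W) : extDim V W.toRep = genExt V γ := by
  have h₁ := homDim_sub_extDim V W
  have h₂ := homDim_sub_extDim V (exists_isGeneral V γ).choose
  have h₃ := hW (exists_isGeneral V γ).choose
  have h₄ := (exists_isGeneral V γ).choose_spec W
  unfold genExt
  lia

lemma genExt_le (V : Rep F Q) [∀ x : Q, Module.Finite F (V.obj x)] {γ : Q → ℕ}
    (W : RepSpace F γ) : genExt V γ ≤ extDim V W.toRep := by
  have h₁ := homDim_sub_extDim V W
  have h₂ := homDim_sub_extDim V (exists_isGeneral V γ).choose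
  have h₄ := (exists_isGeneral V γ).choose_spec W
  unfold genExt
  lia

instance Subrep.finite_toRep {V : Rep F Q} [∀ x : Q, Module.Finite F (V.obj x)] (K : Subrep V)
    (x : Q) : Module.Finite F (K.toRep.obj x) :=
  inferInstanceAs (Module.Finite F (K.space x))

lemma extDim_subrep_le {V : Rep F Q} [∀ x : Q, Module.Finite F (V.obj x)] (K : Subrep V)
    (W : Rep F Q) [∀ x : Q, Module.Finite F (W.obj x)] : extDim K.toRep W ≤ extDim V W := by
  rw [extDim_eq, extDim_eq]
  refine LinearMap.finrank_le_finrank_of_surjective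
    (f := Submodule.mapQ _ _ (K.restrictArrows W) ?_) ?_
  · rintro _ ⟨f, rfl⟩
    exact ⟨_, K.homDiff_restrict W f⟩
  · intro e
    obtain ⟨e, rfl⟩ := Submodule.mkQ_surjective _ e
    obtain ⟨e, rfl⟩ := K.restrictArrows_surjective W e
    exact ⟨Submodule.mkQ _ e, rfl⟩

/-- If the off-diagonal maps which split on a subrepresentation split on the whole, then the
restriction of extensions to the subrepresentation is injective. -/
lemma extDim_le_subrep {V : Rep F Q} [∀ x : Q, Module.Finite F (V.obj x)] (K : Subrep V)
    (W : Rep F Q) [∀ x : Q, Module.Finite F (W.obj x)]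
    (h : ∀ e, K.restrictArrows W e = 0 → e ∈ LinearMap.range (homDiff V W)) :
    extDim V W ≤ extDim K.toRep W := by
  rw [extDim_eq, extDim_eq]
  refine LinearMap.finrank_le_finrank_of_injective
    (f := Submodule.mapQ _ _ (K.restrictArrows W) ?_) ?_
  · rintro _ ⟨f, rfl⟩
    exact ⟨_, K.homDiff_restrict W f⟩
  · rw [← LinearMap.ker_eq_bot, Submodule.eq_bot_iff]
    intro e he
    obtain ⟨e, rfl⟩ := Submodule.mkQ_surjective _ e
    rw [LinearMap.mem_ker, Submodule.mkQ_apply, Submodule.mapQ_apply,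
      Submodule.Quotient.mk_eq_zero] at he
    obtain ⟨f, hf⟩ := he
    choose f' hf' using fun x => LinearMap.exists_extend (p := K.space x) (f x)
    rw [Submodule.mkQ_apply, Submodule.Quotient.mk_eq_zero]
    have h₁ := h (e - homDiff V W f') (by
      rw [map_sub, ← hf, sub_eq_zero, ← K.homDiff_restrict W f']
      congr 1
      exact funext fun x => (hf' x).symm)
    have := add_mem h₁ (LinearMap.mem_range_self (homDiff V W) f')
    rwa [sub_add_cancel] at this

lemma neg_eulerForm_le_genExt (V : Rep F Q) [∀ x : Q, Module.Finite F (V.obj x)] (γ : Q → ℕ)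
    (K : Subrep V) : -eulerForm K.dimVec γ ≤ genExt V γ := by
  obtain ⟨W, hW⟩ := exists_isGeneral V γ
  have : ∀ x : Q, Module.Finite F (W.toRep.obj x) := fun x =>
    inferInstanceAs (Module.Finite F (Fin (γ x) → F))
  rw [← genExt_eq_of_isGeneral V hW]
  have h₁ := homDim_sub_extDim K.toRep W
  have h₂ := extDim_subrep_le K W.toRep
  change _ = eulerForm K.dimVec γ at h₁
  lia

end Dimension

section Pencil

open Polynomial

variable {F : Type*} [Field F] {X Y A B : Type*} [AddCommGroup X] [Module F X]
  [AddCommGroup Y] [Module F Y] [AddCommGroup A] [Module F A] [AddCommGroup B] [Module F B]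

/-- A vector-valued function of one variable all of whose coordinates are polynomial. -/
def IsPolyCurve (v : F → X) : Prop :=
  ∀ l : X →ₗ[F] F, ∃ q : F[X], ∀ t, l (v t) = q.eval t

lemma IsPolyCurve.const (x : X) : IsPolyCurve (fun _ : F => x) := fun l =>
  ⟨C (l x), fun t => by simp⟩

lemma IsPolyCurve.add {v v' : F → X} (h : IsPolyCurve v) (h' : IsPolyCurve v') :
    IsPolyCurve (fun t => v t + v' t) := fun l => by
  obtain ⟨q, hq⟩ := h l
  obtain ⟨q', hq'⟩ := h' l
  exact ⟨q + q', fun t => by rw [map_add, hq, hq', eval_add]⟩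

lemma IsPolyCurve.smul {v : F → X} (p : F[X]) (h : IsPolyCurve v) :
    IsPolyCurve (fun t => p.eval t • v t) := fun l => by
  obtain ⟨q, hq⟩ := h l
  exact ⟨p * q, fun t => by rw [map_smul, hq, eval_mul, smul_eq_mul]⟩

lemma IsPolyCurve.map {v : F → X} (h : IsPolyCurve v) (g : X →ₗ[F] Y) :
    IsPolyCurve (fun t => g (v t)) := fun l => h (l ∘ₗ g)

lemma IsPolyCurve.sum {ι : Type*} (s : Finset ι) {v : ι → F → X}
    (h : ∀ i ∈ s, IsPolyCurve (v i)) : IsPolyCurve (fun t => ∑ i ∈ s, v i t) := fun l => by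
  choose! q hq using fun i hi => h i hi l
  refine ⟨∑ i ∈ s, q i, fun t => ?_⟩
  rw [map_sum, eval_finsetSum]
  exact Finset.sum_congr rfl fun i hi => hq i hi t

/-- The rank of a polynomial family of linear maps is at least its value at `0`, outside a finite
set of parameters. -/
lemma IsPolyCurve.finite_rank_lt [Module.Finite F A] [Module.Finite F B] {h : F → (A →ₗ[F] B)}
    (hh : IsPolyCurve h) :
    {t : F | Module.finrank F (LinearMap.range (h t)) <
      Module.finrank F (LinearMap.range (h 0))}.Finite := by
  obtain ⟨j, hj⟩ := (h 0).rangeRestrict.exists_rightInverse_of_surjective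
    (LinearMap.range_rangeRestrict _)
  obtain ⟨π, hπ⟩ := (LinearMap.range (h 0)).subtype.exists_leftInverse_of_injective
    (Submodule.ker_subtype _)
  let R := LinearMap.range (h 0)
  let b := Module.finBasis F R
  have hent : ∀ i k, ∃ q : F[X], ∀ t,
      LinearMap.toMatrix b b (π ∘ₗ h t ∘ₗ j) i k = q.eval t := by
    intro i k
    obtain ⟨q, hq⟩ := hh (b.coord i ∘ₗ π ∘ₗ LinearMap.applyₗ (j (b k)))
    exact ⟨q, fun t => by rw [← hq, LinearMap.toMatrix_apply]; rfl⟩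
  choose q hq using hent
  have hdet : ∀ t, LinearMap.det (π ∘ₗ h t ∘ₗ j) = (Matrix.det (Matrix.of q)).eval t := by
    intro t
    rw [← LinearMap.det_toMatrix b, ← coe_evalRingHom, RingHom.map_det]
    congr 1
    ext i k
    rw [hq]
    rfl
  have h0 : LinearMap.det (π ∘ₗ h 0 ∘ₗ j) = 1 := by
    have : π ∘ₗ h 0 ∘ₗ j = LinearMap.id := by
      ext1 y
      have h₁ := congrArg (fun g => g ((h 0).rangeRestrict (j y))) hπ
      exact h₁.trans (congrArg (fun g => g y) hj)
    rw [this, LinearMap.det_id]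
  have hne : Matrix.det (Matrix.of q) ≠ 0 := by
    intro h'
    rw [hdet, h', eval_zero] at h0
    exact zero_ne_one h0
  refine (Polynomial.finite_setOfPred_isRoot hne).subset fun t ht => ?_
  by_contra hr
  have hu : IsUnit (LinearMap.det (π ∘ₗ h t ∘ₗ j)) := by
    rw [isUnit_iff_ne_zero, hdet]
    exact hr
  have hsurj : Function.Surjective (π ∘ₗ h t ∘ₗ j) :=
    by
    rw [← LinearMap.isUnit_iff_isUnit_det, Module.End.isUnit_iff] at hu
    exact hu.surjective
  have h₁ : Function.Surjective (π ∘ₗ (LinearMap.range (h t)).subtype) := by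
    intro y
    obtain ⟨x, hx⟩ := hsurj y
    exact ⟨⟨h t (j x), LinearMap.mem_range_self _ _⟩, hx⟩
  exact absurd (LinearMap.finrank_le_finrank_of_surjective h₁) (not_le.2 ht)

/-- If the pencil `φ + tψ` has its largest rank at `t = 0`, then `ψ` maps `ker φ` to `im φ`. -/
lemma mem_range_of_pencil [Infinite F] [Module.Finite F X] [Module.Finite F Y]
    {φ ψ : X →ₗ[F] Y}
    (h : ∀ t : F, Module.finrank F (LinearMap.ker φ) ≤ Module.finrank F (LinearMap.ker (φ + t • ψ)))
    {x : X} (hx : φ x = 0) : ψ x ∈ LinearMap.range φ := by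
  by_contra hn
  let H : F → (X × F →ₗ[F] Y) := fun t =>
    (φ + t • ψ).coprod (LinearMap.toSpanSingleton F Y (ψ x))
  have hH : IsPolyCurve H := by
    let H₀ : X × F →ₗ[F] Y := φ.coprod (LinearMap.toSpanSingleton F Y (ψ x))
    let H₁ : X × F →ₗ[F] Y := ψ ∘ₗ LinearMap.fst F X F
    have : H = fun t => H₀ + (Polynomial.X : F[X]).eval t • H₁ := by
      funext t
      ext <;> simp [H, H₀, H₁]
    rw [this]
    exact (IsPolyCurve.const _).add ((IsPolyCurve.const _).smul _)
  have hfin := hH.finite_rank_lt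
  have h0 : Module.finrank F (LinearMap.range φ) < Module.finrank F (LinearMap.range (H 0)) := by
    apply Submodule.finrank_lt_finrank_of_lt
    refine lt_of_le_of_ne ?_ fun h' => hn ?_
    · rintro _ ⟨y, rfl⟩
      exact ⟨(y, 0), by simp [H]⟩
    · rw [h']
      exact ⟨(0, 1), by simp [H]⟩
  obtain ⟨t, ht⟩ := (hfin.union (Set.finite_singleton 0)).exists_notMem
  simp only [Set.mem_union, Set.mem_ofPred_eq, Set.mem_singleton_iff, not_or, not_lt] at ht
  have hle : LinearMap.range (H t) ≤ LinearMap.range (φ + t • ψ) := by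
    rintro _ ⟨⟨y, c⟩, rfl⟩
    refine ⟨y + (c * t⁻¹) • x, ?_⟩
    have : (φ + t • ψ) x = t • ψ x := by simp [hx]
    rw [map_add, map_smul, this, smul_smul, mul_assoc, inv_mul_cancel₀ ht.2, mul_one]
    simp [H]
  have h₁ := Submodule.finrank_mono hle
  have h₂ := φ.finrank_range_add_finrank_ker
  have h₃ := (φ + t • ψ).finrank_range_add_finrank_ker
  have h₄ := h t
  omega

/-- If the pencil `φ + tψ` has its largest rank at `t = 0`, then every first-order deformation of
an element of `ker φ` extends to a curve in the kernels of the pencil. -/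
lemma exists_deformation [Module.Finite F X] [Module.Finite F Y]
    {φ ψ : X →ₗ[F] Y}
    (h : ∀ t : F, Module.finrank F (LinearMap.ker φ) ≤ Module.finrank F (LinearMap.ker (φ + t • ψ)))
    {f f' : X} (hf : φ f = 0) (hf' : φ f' + ψ f = 0) :
    ∃ (p : F[X]) (v : F → X), p.eval 0 = 1 ∧ IsPolyCurve v ∧
      ∀ t, p.eval t ≠ 0 → (φ + t • ψ) (p.eval t • (f + t • f') + t ^ 2 • v t) = 0 := by
  let I := LinearMap.range φ
  obtain ⟨σ, hσ⟩ := φ.rangeRestrict.exists_rightInverse_of_surjective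
    (LinearMap.range_rangeRestrict _)
  obtain ⟨π, hπ⟩ := I.subtype.exists_leftInverse_of_injective (Submodule.ker_subtype _)
  let b := Module.finBasis F I
  let N : Matrix _ _ F := LinearMap.toMatrix b b (π ∘ₗ ψ ∘ₗ σ)
  let M : Matrix _ _ F[X] := 1 + (Polynomial.X : F[X]) • N.map C
  have hπφ : ∀ x, π (φ x) = φ.rangeRestrict x := fun x =>
    congrArg (fun g => g (φ.rangeRestrict x)) hπ
  have hM : ∀ t, Matrix.toLin b b (M.map (eval t)) = π ∘ₗ (φ + t • ψ) ∘ₗ σ := by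
    intro t
    have h₁ : M.map (eval t) = 1 + t • N := by
      ext i k
      simp [M, Matrix.one_apply, apply_ite (eval t)]
      ring
    have h₂ : π ∘ₗ (φ + t • ψ) ∘ₗ σ = LinearMap.id + t • (π ∘ₗ ψ ∘ₗ σ) := by
      ext1 x
      have h₃ : π (φ (σ x)) = x := (hπφ _).trans (congrArg (fun g => g x) hσ)
      simp [h₃]
    rw [h₁, h₂, map_add, Matrix.toLin_one, map_smul, Matrix.toLin_toMatrix]
  let adj : F → (I →ₗ[F] I) := fun t => Matrix.toLin b b (M.adjugate.map (eval t))
  have hadj : ∀ t y, π ((φ + t • ψ) (σ (adj t y))) = M.det.eval t • y := by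
    intro t y
    have h₁ : (π ∘ₗ (φ + t • ψ) ∘ₗ σ) ∘ₗ adj t = M.det.eval t • LinearMap.id := by
      rw [← hM, ← Matrix.toLin_mul, ← coe_evalRingHom, ← Matrix.map_mul, Matrix.mul_adjugate]
      rw [← Matrix.toLin_one b, ← map_smul]
      congr 1
      ext i k
      simp [Matrix.one_apply, apply_ite (eval t)]
    exact congrArg (fun g => g y) h₁
  let z : I := π (ψ f')
  refine ⟨M.det, fun t => -σ (adj t z), ?_, ?_, ?_⟩
  · have : M.map (eval 0) = 1 := by
      ext i k
      simp [M, Matrix.one_apply, apply_ite (eval (0 : F))]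
    rw [← coe_evalRingHom, RingHom.map_det]
    change Matrix.det (M.map (eval 0)) = 1
    rw [this, Matrix.det_one]
  · have h₁ : IsPolyCurve (fun t => adj t z) := by
      have : (fun t => adj t z) =
          fun t => ∑ i, ∑ k, (M.adjugate i k).eval t • (b.repr z k • b i) := by
        funext t
        simp only [adj, Matrix.toLin_apply, Matrix.mulVec, dotProduct, Matrix.map_apply,
          Finset.sum_smul, smul_smul]
      rw [this]
      exact IsPolyCurve.sum _ fun i _ => IsPolyCurve.sum _ fun k _ => (IsPolyCurve.const _).smul _
    exact h₁.map (-σ)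
  · intro t ht
    have hker : LinearMap.ker (φ + t • ψ) = LinearMap.ker (π ∘ₗ (φ + t • ψ)) := by
      apply Submodule.eq_of_le_of_finrank_le
      · intro x hx
        rw [LinearMap.mem_ker] at hx ⊢
        rw [LinearMap.comp_apply, hx, map_zero]
      · have hsurj : Function.Surjective (π ∘ₗ (φ + t • ψ)) := by
          intro y
          refine ⟨(M.det.eval t)⁻¹ • σ (adj t y), ?_⟩
          rw [map_smul, LinearMap.comp_apply, hadj, smul_smul, inv_mul_cancel₀ ht, one_smul]
        have h₂ := φ.finrank_range_add_finrank_ker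
        have h₃ := (π ∘ₗ (φ + t • ψ)).finrank_range_add_finrank_ker
        rw [LinearMap.range_eq_top.2 hsurj, finrank_top] at h₃
        have h₄ := h t
        change Module.finrank F I + _ = _ at h₂
        omega
    rw [← LinearMap.mem_ker, hker, LinearMap.mem_ker, LinearMap.comp_apply]
    have h₁ : (φ + t • ψ) (f + t • f') = t ^ 2 • ψ f' := by
      have : φ f' = -ψ f := eq_neg_of_add_eq_zero_left hf'
      simp only [LinearMap.add_apply, LinearMap.smul_apply, map_add, map_smul, hf, this]
      module
    rw [map_add, map_smul, map_smul, map_add, map_smul, map_smul, h₁, map_neg, map_neg, hadj,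
      map_smul]
    change M.det.eval t • t ^ 2 • z + t ^ 2 • -(M.det.eval t • z) = 0
    module

end Pencil

lemma exists_comp_eq_of_ker_le {F A B C : Type*} [Field F] [AddCommGroup A] [Module F A]
    [AddCommGroup B] [Module F B] [AddCommGroup C] [Module F C] {f : A →ₗ[F] B} {e : A →ₗ[F] C}
    (h : LinearMap.ker f ≤ LinearMap.ker e) : ∃ b : B →ₗ[F] C, b ∘ₗ f = e := by
  obtain ⟨j, hj⟩ := f.rangeRestrict.exists_rightInverse_of_surjective
    (LinearMap.range_rangeRestrict _)
  obtain ⟨b, hb⟩ := LinearMap.exists_extend (e ∘ₗ j)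
  refine ⟨b, LinearMap.ext fun a => ?_⟩
  have h₁ : b (f a) = e (j (f.rangeRestrict a)) :=
    congrArg (fun g => g (f.rangeRestrict a)) hb
  have h₂ : f (j (f.rangeRestrict a)) = f a :=
    congrArg Subtype.val (congrArg (fun g => g (f.rangeRestrict a)) hj)
  rw [LinearMap.comp_apply, h₁, ← sub_eq_zero, ← map_sub]
  exact h (by rw [LinearMap.mem_ker, map_sub, h₂, sub_self])

section Infinite

variable {F : Type u} [Field F] {Q : Type v} [Quiver.{w + 1} Q]

/-- The differential of `V` and a point of the representation space. -/
def pointDiff (V : Rep F Q) {γ : Q → ℕ} (W : RepSpace F γ) :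
    (∀ x : Q, V.obj x →ₗ[F] (Fin (γ x) → F)) →ₗ[F]
      (∀ x y : Q, (x ⟶ y) → (V.obj x →ₗ[F] (Fin (γ y) → F))) :=
  homDiff V W.toRep

/-- Composition of a point of the representation space with linear maps at the vertices. -/
def compPoint (V : Rep F Q) {γ : Q → ℕ} (B : RepSpace F γ) :
    (∀ x : Q, V.obj x →ₗ[F] (Fin (γ x) → F)) →ₗ[F]
      (∀ x y : Q, (x ⟶ y) → (V.obj x →ₗ[F] (Fin (γ y) → F))) where
  toFun f x y a := B x y a ∘ₗ f x
  map_add' f g := by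
    ext1 x
    ext1 y
    ext1 a
    exact LinearMap.comp_add _ _ _
  map_smul' c f := by
    ext1 x
    ext1 y
    ext1 a
    exact LinearMap.comp_smul _ _ _

lemma pointDiff_add_smul (V : Rep F Q) {γ : Q → ℕ} (W B : RepSpace F γ) (t : F) :
    pointDiff V (W + t • B) = pointDiff V W + t • -compPoint V B := by
  refine LinearMap.ext fun f => ?_
  ext1 x
  ext1 y
  ext1 a
  refine LinearMap.ext fun v => ?_
  change f y ((V.map a).hom v) - (W x y a (f x v) + t • B x y a (f x v)) =
    f y ((V.map a).hom v) - W x y a (f x v) + t • -B x y a (f x v)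
  module

lemma isGeneral_iff (V : Rep F Q) {γ : Q → ℕ} (W : RepSpace F γ) :
    IsGeneral V γ W ↔ ∀ W' : RepSpace F γ, Module.finrank F (LinearMap.ker (pointDiff V W)) ≤
      Module.finrank F (LinearMap.ker (pointDiff V W')) := by
  unfold IsGeneral
  simp only [homDim_eq]
  rfl

/-- The kernel of a homomorphism of representations. -/
def kerSubrep {V : Rep F Q} {γ : Q → ℕ} {W : RepSpace F γ}
    {f : ∀ x : Q, V.obj x →ₗ[F] (Fin (γ x) → F)} (hf : pointDiff V W f = 0) : Subrep V where
  space x := LinearMap.ker (f x)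
  map_mem {x y} a z hz := by
    have h : f y ((V.map a).hom z) = W x y a (f x z) :=
      mem_ker_homDiff (V := V) (W := W.toRep).1 hf x y a z
    rw [LinearMap.mem_ker] at hz ⊢
    rw [h, hz, map_zero]

lemma exists_compPoint_eq {V : Rep F Q} {γ : Q → ℕ} {W : RepSpace F γ}
    {f : ∀ x : Q, V.obj x →ₗ[F] (Fin (γ x) → F)} (hf : pointDiff V W f = 0)
    {e : ∀ x y : Q, (x ⟶ y) → (V.obj x →ₗ[F] (Fin (γ y) → F))}
    (he : (kerSubrep hf).restrictArrows W.toRep e = 0) :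
    ∃ B : RepSpace F γ, compPoint V B f = e := by
  have h : ∀ x y (a : x ⟶ y), ∃ b : (Fin (γ x) → F) →ₗ[F] (Fin (γ y) → F), b ∘ₗ f x = e x y a := by
    intro x y a
    refine exists_comp_eq_of_ker_le fun v hv => ?_
    exact congrArg (fun e => e x y a (⟨v, hv⟩ : LinearMap.ker (f x))) he
  choose B hB using h
  exact ⟨B, funext fun x => funext fun y => funext fun a => hB x y a⟩

variable [Fintype Q] [∀ x y : Q, Fintype (x ⟶ y)]

/-- If `f : V → W` has the largest rank among homomorphisms to general representations, then every
homomorphism `ker f → W` takes values in the image of `f`. -/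
lemma mem_range_of_rank_maximal [Infinite F] {V : Rep F Q} [∀ x : Q, Module.Finite F (V.obj x)]
    {γ : Q → ℕ} {W : RepSpace F γ} (hW : IsGeneral V γ W)
    {f : ∀ x : Q, V.obj x →ₗ[F] (Fin (γ x) → F)} (hf : pointDiff V W f = 0)
    (hmax : ∀ (W' : RepSpace F γ) (f' : ∀ x : Q, V.obj x →ₗ[F] (Fin (γ x) → F)),
      IsGeneral V γ W' → pointDiff V W' f' = 0 →
      ∑ x, Module.finrank F (LinearMap.range (f' x)) ≤
        ∑ x, Module.finrank F (LinearMap.range (f x)))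
    {g : ∀ x : Q, LinearMap.ker (f x) →ₗ[F] (Fin (γ x) → F)}
    (hg : homDiff (kerSubrep hf).toRep W.toRep g = 0) (x : Q) (k : LinearMap.ker (f x)) :
    g x k ∈ LinearMap.range (f x) := by
  classical
  by_contra hn
  choose f' hf' using fun x => LinearMap.exists_extend (p := LinearMap.ker (f x)) (g x)
  obtain ⟨B, hB⟩ := exists_compPoint_eq hf (e := pointDiff V W f') (by
    refine ((kerSubrep hf).homDiff_restrict W.toRep f').symm.trans ?_
    refine Eq.trans ?_ hg
    congr 1
    exact funext hf')
  rw [isGeneral_iff] at hW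
  have hpencil : ∀ t : F, Module.finrank F (LinearMap.ker (pointDiff V W)) ≤
      Module.finrank F (LinearMap.ker (pointDiff V W + t • -compPoint V B)) := by
    intro t
    rw [← pointDiff_add_smul]
    exact hW _
  obtain ⟨p, v, hp0, hv, hpv⟩ := exists_deformation hpencil hf (f' := f') (by
    rw [LinearMap.neg_apply, hB, add_neg_cancel])
  let φ : F → ∀ x : Q, V.obj x →ₗ[F] (Fin (γ x) → F) := fun t =>
    p.eval t • (f + t • f') + t ^ 2 • v t
  have hφ : IsPolyCurve φ := by
    have : φ = fun t => (p.eval t • f + (p * Polynomial.X).eval t • f') +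
        (Polynomial.X ^ 2 : Polynomial F).eval t • v t := by
      funext t
      simp only [φ, Polynomial.eval_mul, Polynomial.eval_X, Polynomial.eval_pow]
      module
    rw [this]
    exact (((IsPolyCurve.const _).smul _).add ((IsPolyCurve.const _).smul _)).add (hv.smul _)
  have hφ0 : φ 0 = f := by simp [φ, hp0]
  -- the deformed representation is general for almost all parameters
  have hfin₁ : {t : F | ¬ IsGeneral V γ (W + t • B)}.Finite := by
    have hcurve : IsPolyCurve (fun t : F => pointDiff V W + t • -compPoint V B) := by
      have : (fun t : F => pointDiff V W + t • -compPoint V B) = fun t : F =>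
          pointDiff V W + (Polynomial.X : Polynomial F).eval t • -compPoint V B := by
        simp only [Polynomial.eval_X]
      rw [this]
      exact (IsPolyCurve.const _).add ((IsPolyCurve.const _).smul _)
    refine hcurve.finite_rank_lt.subset fun t ht => ?_
    by_contra h
    refine ht ((isGeneral_iff _ _).2 fun W' => le_trans ?_ (hW W'))
    rw [pointDiff_add_smul]
    have h₁ := (pointDiff V W).finrank_range_add_finrank_ker
    have h₂ := (pointDiff V W + t • -compPoint V B).finrank_range_add_finrank_ker
    rw [Set.mem_ofPred_eq, not_lt, zero_smul, add_zero] at h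
    omega
  have hfin₂ : ∀ y : Q, {t : F | Module.finrank F (LinearMap.range (φ t y)) <
      Module.finrank F (LinearMap.range (f y))}.Finite := by
    intro y
    have h0 : Module.finrank F (LinearMap.range (φ 0 y)) =
        Module.finrank F (LinearMap.range (f y)) := by rw [hφ0]
    rw [← h0]
    exact (hφ.map (LinearMap.proj y)).finite_rank_lt
  let h : F → (V.obj x × F →ₗ[F] (Fin (γ x) → F)) := fun t =>
    (φ t x).coprod (LinearMap.toSpanSingleton F _ (p.eval t • f' x k + t • v t x k))
  have hh : IsPolyCurve h := by
    let i₁ : (∀ x : Q, V.obj x →ₗ[F] (Fin (γ x) → F)) →ₗ[F] (V.obj x × F →ₗ[F] (Fin (γ x) → F)) :=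
      (LinearMap.lcomp F _ (LinearMap.fst F (V.obj x) F)) ∘ₗ LinearMap.proj x
    let i₂ : (∀ x : Q, V.obj x →ₗ[F] (Fin (γ x) → F)) →ₗ[F] (V.obj x × F →ₗ[F] (Fin (γ x) → F)) :=
      (LinearMap.lcomp F _ (LinearMap.toSpanSingleton F (V.obj x) k ∘ₗ LinearMap.snd F (V.obj x) F))
        ∘ₗ LinearMap.proj x
    have : h = fun t => i₁ (φ t) + (p.eval t • i₂ f' +
        (Polynomial.X : Polynomial F).eval t • i₂ (v t)) := by
      funext t
      refine LinearMap.ext fun z => ?_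
      simp [h, i₁, i₂, LinearMap.coprod_apply, LinearMap.toSpanSingleton_apply]
      module
    rw [this]
    exact (hφ.map i₁).add (((IsPolyCurve.const _).smul _).add ((hv.map i₂).smul _))
  have hfin₃ := hh.finite_rank_lt
  have hgk : f' x k = g x k := congrArg (fun e => e k) (hf' x)
  have h0 : Module.finrank F (LinearMap.range (f x)) <
      Module.finrank F (LinearMap.range (h 0)) := by
    apply Submodule.finrank_lt_finrank_of_lt
    refine lt_of_le_of_ne ?_ fun h' => hn ?_
    · rintro _ ⟨y, rfl⟩
      exact ⟨(y, 0), by simp [h, hφ0]⟩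
    · rw [h']
      exact ⟨(0, 1), by simp [h, hp0, hgk, LinearMap.toSpanSingleton_apply]⟩
  have hp : p ≠ 0 := by
    rintro rfl
    simp at hp0
  obtain ⟨t, ht⟩ := ((((Set.finite_singleton (0 : F)).union hfin₁).union
    (Set.finite_iUnion hfin₂)).union (hfin₃.union
      (Polynomial.finite_setOfPred_isRoot hp))).exists_notMem
  simp only [Set.mem_union, Set.mem_ofPred_eq, Set.mem_singleton_iff, not_or, not_lt, not_not,
    Set.mem_iUnion, not_exists, Polynomial.IsRoot.def] at ht
  obtain ⟨⟨⟨ht0, ht₁⟩, ht₂⟩, ht₃, ht₄⟩ := ht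
  have hle : LinearMap.range (h t) ≤ LinearMap.range (φ t x) := by
    rintro _ ⟨⟨y, c⟩, rfl⟩
    have hk : φ t x k = t • (p.eval t • f' x k + t • v t x k) := by
      have : f x k = 0 := k.2
      simp only [φ, Pi.add_apply, Pi.smul_apply, LinearMap.add_apply, LinearMap.smul_apply, this]
      module
    refine ⟨y + (c * t⁻¹) • (k : V.obj x), ?_⟩
    rw [map_add, map_smul, hk, smul_smul, mul_assoc, inv_mul_cancel₀ ht0, mul_one]
    simp [h, LinearMap.toSpanSingleton_apply]
  have hlt : ∑ x, Module.finrank F (LinearMap.range (f x)) <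
      ∑ x, Module.finrank F (LinearMap.range (φ t x)) :=
    Finset.sum_lt_sum (fun y _ => ht₂ y)
      ⟨x, Finset.mem_univ x, h0.trans_le (ht₃.trans (Submodule.finrank_mono hle))⟩
  refine absurd (hmax (W + t • B) (φ t) ht₁ ?_) (not_le.2 hlt)
  rw [pointDiff_add_smul]
  exact hpv t ht₄

theorem exists_extDim_le_of_infinite [Infinite F] (V : Rep F Q)
    [∀ x : Q, Module.Finite F (V.obj x)] (γ : Q → ℕ) :
    ∃ (W : RepSpace F γ) (K : Subrep V), (extDim V W.toRep : ℤ) ≤ -eulerForm K.dimVec γ +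
      ((∑ x, Module.finrank F (V.obj x) * Module.finrank F (V.obj x) : ℕ) : ℤ) := by
  let S : Set ℕ := {m | ∃ (W : RepSpace F γ) (f : ∀ x : Q, V.obj x →ₗ[F] (Fin (γ x) → F)),
    IsGeneral V γ W ∧ pointDiff V W f = 0 ∧ ∑ x, Module.finrank F (LinearMap.range (f x)) = m}
  have hne : S.Nonempty := by
    obtain ⟨W, hW⟩ := exists_isGeneral V γ
    exact ⟨_, W, 0, hW, map_zero _, rfl⟩
  have hbdd : BddAbove S := by
    refine ⟨∑ x, Module.finrank F (V.obj x), ?_⟩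
    rintro _ ⟨W, f, -, -, rfl⟩
    exact Finset.sum_le_sum fun x _ => LinearMap.finrank_range_le _
  obtain ⟨W, f, hW, hf, hm⟩ := Nat.sSup_mem hne hbdd
  have : ∀ x : Q, Module.Finite F (W.toRep.obj x) := fun x =>
    inferInstanceAs (Module.Finite F (Fin (γ x) → F))
  refine ⟨W, kerSubrep hf, ?_⟩
  have h₁ : extDim V W.toRep ≤ extDim (kerSubrep hf).toRep W.toRep := by
    refine extDim_le_subrep _ _ fun e he => ?_
    obtain ⟨B, rfl⟩ := exists_compPoint_eq hf he
    have h := mem_range_of_pencil (φ := pointDiff V W) (ψ := -compPoint V B) (fun t => by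
      rw [← pointDiff_add_smul]
      exact (isGeneral_iff V W).1 hW _) hf
    rw [LinearMap.neg_apply] at h
    exact (Submodule.neg_mem_iff _).1 h
  have h₂ : homDim (kerSubrep hf).toRep W.toRep ≤
      ∑ x, Module.finrank F (V.obj x) * Module.finrank F (V.obj x) := by
    rw [homDim_eq]
    have hmem : ∀ g ∈ LinearMap.ker (homDiff (kerSubrep hf).toRep W.toRep), ∀ x k,
        g x k ∈ LinearMap.range (f x) := fun g hg =>
      mem_range_of_rank_maximal hW hf (fun W' f' hW' hf' => by
        rw [hm]
        exact le_csSup hbdd ⟨W', f', hW', hf', rfl⟩) hg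
    let j : LinearMap.ker (homDiff (kerSubrep hf).toRep W.toRep) →ₗ[F]
        (∀ x : Q, LinearMap.ker (f x) →ₗ[F] LinearMap.range (f x)) :=
      { toFun := fun g x => (g.1 x).codRestrict _ (hmem g.1 g.2 x)
        map_add' := fun _ _ => rfl
        map_smul' := fun _ _ => rfl }
    have hj : Function.Injective j := by
      intro g g' h
      refine Subtype.ext (funext fun x => LinearMap.ext fun k => ?_)
      exact congrArg Subtype.val (congrArg (fun l => l x k) h)
    refine (LinearMap.finrank_le_finrank_of_injective hj).trans ?_
    rw [Module.finrank_pi_fintype]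
    refine Finset.sum_le_sum fun x _ => ?_
    rw [Module.finrank_linearMap]
    exact Nat.mul_le_mul (Submodule.finrank_le _) (LinearMap.finrank_range_le _)
  have h₃ := homDim_sub_extDim (kerSubrep hf).toRep W
  change _ = eulerForm (kerSubrep hf).dimVec γ at h₃
  zify at h₁ h₂ ⊢
  linarith

end Infinite

section Finite

variable {F : Type u} [Field F] {Q : Type v} [Quiver.{w + 1} Q]

lemma Subrep.ext_space {V : Rep F Q} {K K' : Subrep V} (h : ∀ x, K.space x = K'.space x) :
    K = K' := by
  obtain ⟨s, hs⟩ := K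
  obtain ⟨s', hs'⟩ := K'
  obtain rfl : s = s' := funext h
  rfl

/-- Restriction of a family of maps at the vertices to a subrepresentation. -/
noncomputable def Subrep.restrictVertices {V : Rep F Q} (K : Subrep V) (γ : Q → ℕ) :
    (∀ x : Q, V.obj x →ₗ[F] (Fin (γ x) → F)) →ₗ[F]
      (∀ x : Q, K.toRep.obj x →ₗ[F] (Fin (γ x) → F)) where
  toFun f x := f x ∘ₗ (K.space x).subtype
  map_add' _ _ := rfl
  map_smul' _ _ := rfl

lemma Subrep.restrictVertices_surjective {V : Rep F Q} (K : Subrep V) (γ : Q → ℕ) :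
    Function.Surjective (K.restrictVertices γ) := by
  intro f
  choose f' hf' using fun x => LinearMap.exists_extend (p := K.space x) (f x)
  exact ⟨f', funext hf'⟩

variable [Fintype Q] [∀ x y : Q, Fintype (x ⟶ y)]

/-- Evaluation of points of the representation space at fixed linear maps at the vertices. -/
def evalPoint (V : Rep F Q) {γ : Q → ℕ} (f : ∀ x : Q, V.obj x →ₗ[F] (Fin (γ x) → F)) :
    RepSpace F γ →ₗ[F] (∀ x y : Q, (x ⟶ y) → (V.obj x →ₗ[F] (Fin (γ y) → F))) where
  toFun B := compPoint V B f
  map_add' _ _ := rfl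
  map_smul' _ _ := rfl

lemma finrank_ker_evalPoint_le {V : Rep F Q} [∀ x : Q, Module.Finite F (V.obj x)] {γ : Q → ℕ}
    {W : RepSpace F γ} {f : ∀ x : Q, V.obj x →ₗ[F] (Fin (γ x) → F)} (hf : pointDiff V W f = 0) :
    Module.finrank F (LinearMap.ker (evalPoint V f)) +
      Module.finrank F (∀ x y : Q, (x ⟶ y) → (V.obj x →ₗ[F] (Fin (γ y) → F))) ≤
    Module.finrank F (RepSpace F γ) + Module.finrank F
      (∀ x y : Q, (x ⟶ y) → ((kerSubrep hf).toRep.obj x →ₗ[F] (Fin (γ y) → F))) := by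
  let ρ : (∀ x y : Q, (x ⟶ y) → (V.obj x →ₗ[F] (Fin (γ y) → F))) →ₗ[F]
      (∀ x y : Q, (x ⟶ y) → ((kerSubrep hf).toRep.obj x →ₗ[F] (Fin (γ y) → F))) :=
    (kerSubrep hf).restrictArrows W.toRep
  have h₁ := (evalPoint V f).finrank_range_add_finrank_ker
  have h₂ := ρ.finrank_range_add_finrank_ker
  have h₃ : Module.finrank F (LinearMap.ker ρ) ≤
      Module.finrank F (LinearMap.range (evalPoint V f)) :=
    Submodule.finrank_mono fun e he => exists_compPoint_eq hf he
  have h₄ := Submodule.finrank_le (LinearMap.range ρ)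
  omega

instance finite_subrep [Finite F] (V : Rep F Q) [∀ x : Q, Module.Finite F (V.obj x)] :
    Finite (Subrep V) := by
  have : ∀ x, Finite (V.obj x) := fun x => Module.finite_of_finite F
  exact Finite.of_injective (fun K : Subrep V => K.space)
    fun K K' h => Subrep.ext_space fun x => congrFun h x

theorem exists_extDim_le_of_finite [Finite F] (V : Rep F Q)
    [∀ x : Q, Module.Finite F (V.obj x)] (γ : Q → ℕ) :
    ∃ (W : RepSpace F γ) (K : Subrep V), (extDim V W.toRep : ℤ) ≤ -eulerForm K.dimVec γ +
      (Nat.card (Subrep V) : ℤ) := by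
  classical
  let X := ∀ x : Q, V.obj x →ₗ[F] (Fin (γ x) → F)
  have : Finite (RepSpace F γ) := Module.finite_of_finite F
  have : Finite X := Module.finite_of_finite F
  have := Fintype.ofFinite (RepSpace F γ)
  have := Fintype.ofFinite X
  have := Fintype.ofFinite (Subrep V)
  let q := Nat.card F
  have hq : 1 < q := Finite.one_lt_card
  let T := Σ W : RepSpace F γ, LinearMap.ker (pointDiff V W)
  have := Fintype.ofFinite T
  let κ : T → Subrep V := fun s => kerSubrep (LinearMap.mem_ker.1 s.2.2)
  obtain ⟨W, hW⟩ := exists_isGeneral V γ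
  -- a lower bound for the number of pairs of a point and a homomorphism to it
  have hT : q ^ (Module.finrank F (RepSpace F γ) + homDim V W.toRep) ≤ Fintype.card T := by
    have h₁ : Fintype.card T = ∑ W : RepSpace F γ, Nat.card (LinearMap.ker (pointDiff V W)) := by
      rw [← Nat.card_eq_fintype_card, Nat.card_sigma]
    have h₂ : ∀ W' : RepSpace F γ, q ^ homDim V W.toRep ≤
        Nat.card (LinearMap.ker (pointDiff V W')) := by
      intro W'
      rw [Module.natCard_eq_pow_finrank (K := F), homDim_eq]
      exact Nat.pow_le_pow_right hq.le ((isGeneral_iff V W).1 hW W')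
    rw [h₁, pow_add, ← Module.natCard_eq_pow_finrank (K := F), Nat.card_eq_fintype_card]
    exact (Finset.card_nsmul_le_sum Finset.univ _ _ fun W' _ => h₂ W')
  have hTpos : 0 < Fintype.card T := (Nat.pow_pos (by omega)).trans_le hT
  obtain ⟨s₀⟩ := Fintype.card_pos_iff.1 hTpos
  -- the kernel which occurs most often
  let n : Subrep V → ℕ := fun K => (Finset.univ.filter fun s : T => κ s = K).card
  obtain ⟨K, -, hK⟩ := Finset.exists_max_image Finset.univ n ⟨κ s₀, Finset.mem_univ _⟩
  have hTK : Fintype.card T ≤ Nat.card (Subrep V) * n K := by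
    rw [← Finset.card_univ, Finset.card_eq_sum_card_fiberwise (f := κ) (t := Finset.univ)
      (fun _ _ => Finset.mem_coe.2 (Finset.mem_univ _)), Nat.card_eq_fintype_card]
    exact Finset.sum_le_card_nsmul Finset.univ n (n K) hK
  have hnK : 0 < n K := by
    by_contra h
    rw [Nat.eq_zero_of_not_pos h, mul_zero] at hTK
    omega
  obtain ⟨s₁, hs₁⟩ := Finset.card_pos.1 hnK
  have hs₁ : κ s₁ = K := (Finset.mem_filter.1 hs₁).2
  let yK := Module.finrank F (∀ x y : Q, (x ⟶ y) → (K.toRep.obj x →ₗ[F] (Fin (γ y) → F)))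
  let yV := Module.finrank F (∀ x y : Q, (x ⟶ y) → (V.obj x →ₗ[F] (Fin (γ y) → F)))
  have hk : ∀ s : T, κ s = K → Module.finrank F (LinearMap.ker (evalPoint V s.2.1)) + yV ≤
      Module.finrank F (RepSpace F γ) + yK := by
    intro s hs
    have h := finrank_ker_evalPoint_le (LinearMap.mem_ker.1 s.2.2)
    change _ ≤ _ + Module.finrank F
      (∀ x y : Q, (x ⟶ y) → ((κ s).toRep.obj x →ₗ[F] (Fin (γ y) → F))) at h
    rwa [hs] at h
  let k := Module.finrank F (RepSpace F γ) + yK - yV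
  let m := Module.finrank F (LinearMap.ker (K.restrictVertices γ))
  have hn : n K ≤ q ^ k * q ^ m := by
    let p : T → X := fun s => s.2.1
    refine (Finset.card_le_mul_card_image (f := p) _ (q ^ k) ?_).trans
      (Nat.mul_le_mul_left _ ?_)
    · intro f hf
      obtain ⟨s, hs, hsf⟩ := Finset.mem_image.1 hf
      have hs := (Finset.mem_filter.1 hs).2
      have hle : q ^ Module.finrank F (LinearMap.ker (evalPoint V f)) ≤ q ^ k := by
        have h := hk s hs
        change s.2.1 = f at hsf
        rw [hsf] at h
        exact Nat.pow_le_pow_right hq.le (by omega)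
      refine le_trans ?_ hle
      refine le_trans ?_
        (Module.natCard_eq_pow_finrank (K := F) (V := LinearMap.ker (evalPoint V f))).le
      rw [← SetLike.coe_sort_coe, Nat.card_eq_card_toFinset]
      have hmem : ∀ s' : T, p s' = f → compPoint V s'.1 f = pointDiff V 0 f := by
        rintro ⟨W', f', hf'⟩ rfl
        have h := pointDiff_add_smul V 0 W' 1
        rw [zero_add, one_smul] at h
        rw [LinearMap.mem_ker, h, one_smul, LinearMap.add_apply, LinearMap.neg_apply] at hf'
        exact (sub_eq_zero.1 ((sub_eq_add_neg _ _).trans hf')).symm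
      refine Finset.card_le_card_of_injOn (fun s' => s'.1 - s.1) ?_ ?_
      · intro s' hs'
        have hs' := (Finset.mem_filter.1 (Finset.mem_coe.1 hs')).2
        rw [Set.coe_toFinset, SetLike.mem_coe, LinearMap.mem_ker, map_sub]
        change compPoint V s'.1 f - compPoint V s.1 f = 0
        rw [hmem s' hs', hmem s hsf, sub_self]
      · rintro ⟨W', f', hf'⟩ h' ⟨W'', f'', hf''⟩ h'' h
        obtain rfl : f' = f := (Finset.mem_filter.1 (Finset.mem_coe.1 h')).2
        obtain rfl : f'' = f' := (Finset.mem_filter.1 (Finset.mem_coe.1 h'')).2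
        obtain rfl : W' = W'' := sub_left_injective h
        rfl
    · refine le_trans ?_
        (Module.natCard_eq_pow_finrank (K := F) (V := LinearMap.ker (K.restrictVertices γ))).le
      rw [← SetLike.coe_sort_coe, Nat.card_eq_card_toFinset]
      refine Finset.card_le_card fun f hf => ?_
      obtain ⟨s, hs, hsf⟩ := Finset.mem_image.1 hf
      have hs := (Finset.mem_filter.1 hs).2
      rw [Set.mem_toFinset, SetLike.mem_coe, LinearMap.mem_ker]
      refine funext fun x => LinearMap.ext fun z => ?_
      have hz : z.1 ∈ (κ s).space x := by
        rw [hs]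
        exact z.2
      rw [← hsf]
      exact hz
  have hpow : q ^ (Module.finrank F (RepSpace F γ) + homDim V W.toRep) ≤
      q ^ (Nat.card (Subrep V) + (k + m)) := by
    refine hT.trans (hTK.trans ?_)
    rw [pow_add, pow_add]
    exact Nat.mul_le_mul (Nat.lt_pow_self hq).le hn
  have hle := (Nat.pow_le_pow_iff_right hq).1 hpow
  refine ⟨W, K, ?_⟩
  have h₁ := homDim_sub_extDim V W
  have h₂ := eulerForm_finrank V γ
  have h₃ := eulerForm_finrank K.toRep γ
  change eulerForm K.dimVec γ = _ at h₃
  have h₄ := (K.restrictVertices γ).finrank_range_add_finrank_ker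
  rw [LinearMap.range_eq_top.2 (K.restrictVertices_surjective γ), finrank_top] at h₄
  have h₅ := hk s₁ hs₁
  have h₆ : k + yV = Module.finrank F (RepSpace F γ) + yK := by omega
  change _ = _ - (yV : ℤ) at h₂
  change _ = _ - (yK : ℤ) at h₃
  change _ + m = _ at h₄
  omega

end Finite

section Limit

variable {F : Type u} [Field F] {Q : Type v} [Quiver.{w + 1} Q] [Fintype Q]
  [∀ x y : Q, Fintype (x ⟶ y)]

lemma exists_genExt_le (V : Rep F Q) [∀ x : Q, Module.Finite F (V.obj x)] :
    ∃ C : ℕ, ∀ γ : Q → ℕ, ∃ K : Subrep V, (genExt V γ : ℤ) ≤ -eulerForm K.dimVec γ + C := by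
  have h : ∃ C : ℕ, ∀ γ : Q → ℕ, ∃ (W : RepSpace F γ) (K : Subrep V),
      (extDim V W.toRep : ℤ) ≤ -eulerForm K.dimVec γ + C := by
    rcases finite_or_infinite F with hF | hF
    · exact ⟨_, exists_extDim_le_of_finite V⟩
    · exact ⟨_, exists_extDim_le_of_infinite V⟩
  obtain ⟨C, hC⟩ := h
  refine ⟨C, fun γ => ?_⟩
  obtain ⟨W, K, h⟩ := hC γ
  exact ⟨K, (Int.ofNat_le.2 (genExt_le V W)).trans h⟩

lemma eulerForm_smul (α β : Q → ℕ) (d : ℕ) : eulerForm α (d • β) = d * eulerForm α β := by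
  unfold eulerForm
  simp only [Pi.smul_apply, smul_eq_mul, Nat.cast_mul, mul_sub, Finset.mul_sum]
  simp only [mul_left_comm]

lemma exists_isGreatest_neg_eulerForm (V : Rep F Q) [∀ x : Q, Module.Finite F (V.obj x)]
    (β : Q → ℕ) : ∃ K : Subrep V, ∀ K' : Subrep V,
      -eulerForm K'.dimVec β ≤ -eulerForm K.dimVec β := by
  have hfin : (Set.range fun K : Subrep V => -eulerForm K.dimVec β).Finite := by
    classical
    have h : (Set.Icc 0 fun x : Q => Module.finrank F (V.obj x)).Finite := Set.finite_Icc _ _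
    refine (h.image fun α : Q → ℕ => -eulerForm α β).subset ?_
    rintro _ ⟨K, rfl⟩
    exact ⟨K.dimVec, ⟨fun _ => Nat.zero_le _, fun x => Submodule.finrank_le _⟩, rfl⟩
  have hne : (Set.range fun K : Subrep V => -eulerForm K.dimVec β).Nonempty :=
    ⟨_, ⟨fun _ => ⊤, fun _ _ _ => Submodule.mem_top⟩, rfl⟩
  obtain ⟨_, ⟨K, rfl⟩, hK⟩ := Set.exists_max_image _ id hfin hne
  exact ⟨K, fun K' => hK _ ⟨K', rfl⟩⟩

lemma tendsto_genExt_div (V : Rep F Q) [∀ x : Q, Module.Finite F (V.obj x)] (β : Q → ℕ)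
    {K : Subrep V} (hK : ∀ K' : Subrep V, -eulerForm K'.dimVec β ≤ -eulerForm K.dimVec β) :
    Tendsto (fun d : ℕ => (genExt V (d • β) : ℝ) / (d : ℝ)) atTop
      (𝓝 ((-eulerForm K.dimVec β : ℤ) : ℝ)) := by
  obtain ⟨C, hC⟩ := exists_genExt_le V
  set m : ℤ := -eulerForm K.dimVec β with hm
  have hlow : ∀ d : ℕ, (d : ℤ) * m ≤ genExt V (d • β) := by
    intro d
    have h := neg_eulerForm_le_genExt V (d • β) K
    rwa [eulerForm_smul, ← mul_neg] at h
  have hup : ∀ d : ℕ, (genExt V (d • β) : ℤ) ≤ d * m + C := by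
    intro d
    obtain ⟨K', h⟩ := hC (d • β)
    rw [eulerForm_smul, ← mul_neg] at h
    have := mul_le_mul_of_nonneg_left (hK K') (Int.natCast_nonneg d)
    linarith
  have hlim : Tendsto (fun d : ℕ => (m : ℝ) + (C : ℝ) / (d : ℝ)) atTop (𝓝 (m : ℝ)) := by
    simpa using (tendsto_const_div_atTop_nhds_zero_nat (C : ℝ)).const_add (m : ℝ)
  refine tendsto_of_tendsto_of_tendsto_of_le_of_le' tendsto_const_nhds hlim ?_ ?_
  · filter_upwards [eventually_gt_atTop 0] with d hd
    have hd : (0 : ℝ) < d := Nat.cast_pos.2 hd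
    rw [le_div_iff₀ hd, mul_comm]
    exact_mod_cast hlow d
  · filter_upwards [eventually_gt_atTop 0] with d hd
    have hd : (0 : ℝ) < d := Nat.cast_pos.2 hd
    rw [div_le_iff₀ hd, add_mul, div_mul_cancel₀ _ hd.ne', mul_comm]
    exact_mod_cast hup d

end Limit
end QuiverRep

theorem mainTheorem2 {F : Type u} [Field F] {Q : Type v} [Quiver.{w + 1} Q] [Fintype Q]
    [∀ x y : Q, Fintype (x ⟶ y)] (V : QuiverRep.Rep F Q) [∀ x : Q, Module.Finite F (V.obj x)]
    (β : Q → ℕ) :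
    (∀ (d : ℕ) (W : QuiverRep.RepSpace F (d • β)), QuiverRep.IsGeneral V (d • β) W →
      QuiverRep.extDim V W.toRep = QuiverRep.genExt V (d • β)) ∧
    Tendsto (fun d : ℕ => (QuiverRep.genExt V (d • β) : ℝ) / (d : ℝ)) atTop
      (𝓝 (QuiverRep.ncext V β)) ∧
    IsGreatest
      {r : ℝ | ∃ V' : QuiverRep.Subrep V, r = ((-QuiverRep.eulerForm V'.dimVec β : ℤ) : ℝ)}
      (QuiverRep.ncext V β) := by
  obtain ⟨K, hK⟩ := QuiverRep.exists_isGreatest_neg_eulerForm V β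
  have hlim := QuiverRep.tendsto_genExt_div V β hK
  have hncext : QuiverRep.ncext V β = ((-QuiverRep.eulerForm K.dimVec β : ℤ) : ℝ) :=
    hlim.limUnder_eq
  rw [hncext]
  refine ⟨fun d W hW => QuiverRep.genExt_eq_of_isGeneral V hW, hlim, ⟨K, rfl⟩, ?_⟩
  rintro _ ⟨K', rfl⟩
  exact_mod_cast hK K'
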